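/- Let $\mathbb D$ be the open unit disk in $\mathbb C$. The Dirichlet space $\mathcal D$ is the space of holomorphic functions $f$ on $\mathbb D$ with $\mathcal D(f):=\frac1\pi\int_{\mathbb D}|f'(z)|^2\,dA(z)<\infty$, normed by $\|f\|_{\mathcal D}^2:=|f(0)|^2+\mathcal D(f)$. A positive Borel measure $\mu$ on $\mathbb D$ is called a Carleson measure for $\mathcal D$ if there is a constant $C$ such that $\int_{\mathbb D}|f|^2\,d\mu\le C\|f\|_{\mathcal D}^2$ for all $f\in\mathcal D$. For an arc $I$ of the unit circle of arclength $|I|>0$, let $S(I):=\{re^{i\theta}: r\ge 0,\ 1-|I|<r<1,\ e^{i\theta}\in I\}$. **Theorem.** Let $\phi:(0,2\pi]\to(0,\infty)$ be a continuous increasing (not necessarily strictly increasing) function such that $\phi(x)/x$ is strictly decreasing on $(0,2\pi]$ and $$\int_0^{2\pi}\frac{\phi(x)}{x}\,dx=\infty.$$ Then there exists a finite positive Borel measure $\mu$ on $\mathbb D$ such that $\mu(S(I))=O(\phi(|I|))$ as $|I|\to0$ (that is, there are constants $C$ and $\delta>0$ such that $\mu(S(I))\le C\phi(|I|)$ for every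 arc $I$ with $|I|<\delta$), but $\mu$ is not a Carleson measure for $\mathcal D$. -/

import Mathlib

open scoped ENNReal NNReal

noncomputable section

namespace DirichletCarleson

/-- The open unit disk in the complex plane. -/
def disk : Set ℂ := Metric.ball 0 1

/-- The Dirichlet integral `(1/π) ∫_𝔻 |f'|² dA`, with values in `[0, ∞]`. -/
def dirichletIntegral (f : ℂ → ℂ) : ℝ≥0∞ :=
  ENNReal.ofReal (1 / Real.pi) * ∫⁻ z in disk, ‖deriv f z‖ₑ ^ 2

/-- `f` belongs to the Dirichlet space: it is holomorphic in the disk and its Dirichlet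
integral is finite. (Only the restriction of `f` to the disk matters.) -/
def MemDirichlet (f : ℂ → ℂ) : Prop :=
  DifferentiableOn ℂ f disk ∧ dirichletIntegral f < ∞

/-- The squared Dirichlet norm `|f(0)|² + 𝒟(f)`. -/
def dirichletNormSq (f : ℂ → ℂ) : ℝ≥0∞ :=
  ‖f 0‖ₑ ^ 2 + dirichletIntegral f

/-- `μ` is a Carleson measure for the Dirichlet space: there is a constant `C` such that
`∫_𝔻 |f|² dμ ≤ C ‖f‖²` for all `f` in the Dirichlet space. -/
def IsDirichletCarleson (μ : MeasureTheory.Measure ℂ) : Prop :=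
  ∃ C : ℝ≥0, ∀ f : ℂ → ℂ, MemDirichlet f →
    ∫⁻ z in disk, ‖f z‖ₑ ^ 2 ∂μ ≤ C * dirichletNormSq f

/-- `I` is a (nondegenerate) arc of the unit circle of arclength `ℓ`, with endpoints
`e^{ia}` and `e^{ib}`, where `ℓ = b - a`. Each endpoint may or may not belong to `I`. -/
def IsArc (I : Set ℂ) (ℓ : ℝ) : Prop :=
  ∃ a b : ℝ, a < b ∧ b ≤ a + 2 * Real.pi ∧ ℓ = b - a ∧
    (fun θ : ℝ => Complex.exp (θ * Complex.I)) '' Set.Ioo a b ⊆ I ∧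
    I ⊆ (fun θ : ℝ => Complex.exp (θ * Complex.I)) '' Set.Icc a b

/-- The Carleson box `S(I) = {r e^{iθ} : 1 - |I| < r < 1, e^{iθ} ∈ I}` of an arc `I` of
arclength `ℓ`. -/
def carlesonBox (I : Set ℂ) (ℓ : ℝ) : Set ℂ :=
  {z | ∃ (r : ℝ) (ζ : ℂ), 0 ≤ r ∧ 1 - ℓ < r ∧ r < 1 ∧ ζ ∈ I ∧ z = r * ζ}

/-- The one-box condition `μ(S(I)) = O(φ(|I|))` as `|I| → 0`. -/
def OneBoxCondition (μ : MeasureTheory.Measure ℂ) (φ : ℝ → ℝ) : Prop :=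
  ∃ C δ : ℝ, 0 < δ ∧ ∀ (I : Set ℂ) (ℓ : ℝ), IsArc I ℓ → ℓ < δ →
    μ (carlesonBox I ℓ) ≤ ENNReal.ofReal (C * φ ℓ)

end DirichletCarleson

end

open scoped ENNReal NNReal

noncomputable section

namespace DirichletCarleson

/-! A Carleson measure controls logarithmic energy, while the one-box condition does not. For the
uniform probability measure `ν` on finitely many points of the disk, test the Carleson inequality on
its potential `f`, the mean of `-log (1 - conj w * z)` over these points. The reproducing property
gives `𝒟(f) = E`, the energy of `ν`, and `f 0 = 0`; Cauchy–Schwarz gives `∫ |f|² dν ≥ E²`. Hence `a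
• ν ≤ μ` with `μ` Carleson forces `a * E ≤ C` (`mul_logEnergy_le_of_smul_uniformMeasure_le`).

It remains to find such `ν` with `E` arbitrarily large and a common one-box constant. Choose scales
`l k` at which `φ` is successively halved. As `φ x / x` decreases, `2 * l (k + 1) ≤ l k`, so a
Cantor construction with these lengths exists; its intervals of stage `k` have mass `2⁻ᵏ`,
comparable to `φ (l k)`, which is the one-box bound. Its energy is at least, up to additive
constants, `∑ 2⁻⁽ᵏ⁺¹⁾ log (l k / l (k + 1))`, and this sum dominates a multiple of `∫ φ x / x`
(`exists_scales`, `le_logEnergy_cantorPoint`). Weights `2⁻ʲ` on measures of energy at least `4ʲ`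
then give `μ`. -/

/-- The angles of the `n`-th stage of a Cantor construction in which the intervals of stage `k`
have length `l k`: those with index below `2 ^ n` are the left endpoints of the intervals. -/
def cantorAngle (l : ℕ → ℝ) : ℕ → ℕ → ℝ
  | 0, p => p * l 0
  | n + 1, p => cantorAngle l n (p / 2) + ((p % 2 : ℕ) : ℝ) * (l n - l (n + 1))

/-! ### Geometry of the Cantor angles -/

section Cantor

variable {l : ℕ → ℝ} (hl0 : ∀ k, 0 < l k) (hl : ∀ k, 2 * l (k + 1) ≤ l k)

-- Halving leaves room for two disjoint children, and a right child ends where its parent does.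
-- Stage `0` tiles the half-line, so `p` needs no upper bound.
include hl in
theorem cantorAngle_add_le_succ (n p : ℕ) :
    cantorAngle l n p + l n ≤ cantorAngle l n (p + 1) := by
  induction n generalizing p with
  | zero => simp only [cantorAngle]; push_cast; linarith
  | succ n ih =>
    simp only [cantorAngle]
    have := hl n
    rcases Nat.even_or_odd' p with ⟨q, rfl | rfl⟩
    · have h1 : 2 * q / 2 = q := by omega
      have h2 : (2 * q + 1) / 2 = q := by omega
      have h3 : 2 * q % 2 = 0 := by omega
      have h4 : (2 * q + 1) % 2 = 1 := by omega
      rw [h1, h2, h3, h4]; push_cast; linarith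
    · have h1 : (2 * q + 1) / 2 = q := by omega
      have h2 : (2 * q + 1 + 1) / 2 = q + 1 := by omega
      have h3 : (2 * q + 1) % 2 = 1 := by omega
      have h4 : (2 * q + 1 + 1) % 2 = 0 := by omega
      have := ih q
      rw [h1, h2, h3, h4]; push_cast; linarith

include hl0 hl in
theorem cantorAngle_mono (n : ℕ) : Monotone (cantorAngle l n) :=
  monotone_nat_of_le_succ fun p => by
    have := cantorAngle_add_le_succ hl n p
    have := hl0 n
    linarith

include hl0 hl in
theorem antitone_of_halving : Antitone l :=
  antitone_nat_of_succ_le fun k => by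
    have := hl k
    have := hl0 (k + 1)
    linarith

-- Adding `2 ^ (n - k)` to the index replaces the ancestor of stage `k` by its successor and keeps
-- the lower binary digits, that is, the position inside the ancestor.
include hl in
theorem cantorAngle_add_le_add_two_pow {k n : ℕ} (hkn : k ≤ n) (p : ℕ) :
    cantorAngle l n p + l k ≤ cantorAngle l n (p + 2 ^ (n - k)) := by
  induction n, hkn using Nat.le_induction generalizing p with
  | base => simpa using cantorAngle_add_le_succ hl k p
  | succ n hkn ih =>
    simp only [cantorAngle]
    have e : 2 ^ (n + 1 - k) = 2 * 2 ^ (n - k) := by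
      rw [Nat.sub_add_comm hkn, pow_succ, mul_comm]
    have h1 : (p + 2 ^ (n + 1 - k)) / 2 = p / 2 + 2 ^ (n - k) := by omega
    have h2 : (p + 2 ^ (n + 1 - k)) % 2 = p % 2 := by omega
    rw [h1, h2]
    linarith [ih (p / 2)]

-- Intervals are nested: `p / 2 ^ j` indexes the ancestor `j` stages earlier.
include hl0 hl in
theorem cantorAngle_mem_ancestor (n j p : ℕ) :
    cantorAngle l n (p / 2 ^ j) ≤ cantorAngle l (n + j) p ∧
      cantorAngle l (n + j) p ≤ cantorAngle l n (p / 2 ^ j) + l n - l (n + j) := by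
  induction j generalizing p with
  | zero => simp
  | succ j ih =>
    have e : p / 2 ^ (j + 1) = p / 2 / 2 ^ j := by rw [pow_succ', Nat.div_div_eq_div_mul]
    obtain ⟨h1, h2⟩ := ih (p / 2)
    rw [e, ← add_assoc]
    simp only [cantorAngle]
    have := hl (n + j)
    have := hl0 (n + j + 1)
    rcases Nat.mod_two_eq_zero_or_one p with h | h <;> rw [h] <;> push_cast <;>
      constructor <;> linarith

include hl0 hl in
theorem abs_cantorAngle_sub_le {k n p q : ℕ} (hkn : k ≤ n)
    (h : p / 2 ^ (n - k) = q / 2 ^ (n - k)) :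
    |cantorAngle l n p - cantorAngle l n q| ≤ l k := by
  obtain ⟨j, rfl⟩ := Nat.exists_eq_add_of_le hkn
  rw [Nat.add_sub_cancel_left] at h
  have h1 := cantorAngle_mem_ancestor hl0 hl k j p
  have h2 := cantorAngle_mem_ancestor hl0 hl k j q
  rw [h] at h1
  have := hl0 (k + j)
  rw [abs_le]
  constructor <;> linarith [h1.1, h1.2, h2.1, h2.2]

-- Otherwise some index exceeds the smallest one by at least `2 ^ (n - k)`, which puts the two
-- angles at least `l k` apart.
include hl0 hl in
theorem card_le_of_abs_cantorAngle_sub_lt {k n : ℕ} (hkn : k ≤ n) (F : Finset ℕ)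
    (hF : ∀ p ∈ F, ∀ q ∈ F, |cantorAngle l n p - cantorAngle l n q| < l k) :
    F.card ≤ 2 ^ (n - k) := by
  rcases F.eq_empty_or_nonempty with rfl | hne
  · simp
  have hsub : F ⊆ Finset.Ico (F.min' hne) (F.min' hne + 2 ^ (n - k)) := by
    intro q hq
    rw [Finset.mem_Ico]
    refine ⟨Finset.min'_le _ _ hq, ?_⟩
    by_contra! hlt
    have h1 := cantorAngle_mono hl0 hl n hlt
    have h2 := cantorAngle_add_le_add_two_pow hl hkn (F.min' hne)
    have h3 := hF q hq _ (F.min'_mem hne)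
    have := (abs_lt.1 h3).2
    linarith
  simpa using Finset.card_le_card hsub

/-! ### Energy of the Cantor points -/

/-- The points of the disk above the left endpoints of the `n`-th stage of a Cantor set. -/
def cantorPoint (l : ℕ → ℝ) (n p : ℕ) : ℂ :=
  ((1 - l n : ℝ) : ℂ) * Complex.exp (cantorAngle l n p * Complex.I)

theorem norm_cantorPoint {n : ℕ} (h : l n ≤ 1) (p : ℕ) : ‖cantorPoint l n p‖ = 1 - l n := by
  rw [cantorPoint, norm_mul, Complex.norm_exp_ofReal_mul_I, mul_one, Complex.norm_real,
    Real.norm_of_nonneg (by linarith)]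

-- With `ρ = 1 - l n` and `t` the difference of the angles, the quantity is `1 - ρ² e^{it}`, of
-- modulus at most `(1 - ρ²) + ρ² |t| ≤ 2 * l n + l k`.
include hl0 hl in
theorem norm_one_sub_conj_cantorPoint_mul_le {k n p q : ℕ} (hkn : k ≤ n) (h1 : l n ≤ 1)
    (h : p / 2 ^ (n - k) = q / 2 ^ (n - k)) :
    ‖1 - starRingEnd ℂ (cantorPoint l n q) * cantorPoint l n p‖ ≤ 3 * l k := by
  set t := cantorAngle l n p - cantorAngle l n q with ht
  have e : 1 - starRingEnd ℂ (cantorPoint l n q) * cantorPoint l n p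
      = ((1 - (1 - l n) ^ 2 : ℝ) : ℂ)
        - (((1 - l n) ^ 2 : ℝ) : ℂ) * (Complex.exp (Complex.I * t) - 1) := by
    have : Complex.exp (Complex.I * t) = Complex.exp (-(cantorAngle l n q * Complex.I))
        * Complex.exp (cantorAngle l n p * Complex.I) := by
      rw [← Complex.exp_add]; congr 1; rw [ht]; push_cast; ring
    rw [this, cantorPoint, cantorPoint, map_mul, ← Complex.exp_conj, map_mul, Complex.conj_ofReal,
      Complex.conj_I, Complex.conj_ofReal, mul_neg]
    push_cast; ring
  have hln := hl0 n
  have hk := antitone_of_halving hl0 hl hkn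
  have hsq : (1 - l n) ^ 2 ≤ 1 := by nlinarith
  calc _ ≤ ‖((1 - (1 - l n) ^ 2 : ℝ) : ℂ)‖
        + ‖(((1 - l n) ^ 2 : ℝ) : ℂ) * (Complex.exp (Complex.I * t) - 1)‖ := by
        rw [e]; exact norm_sub_le _ _
    _ = (1 - (1 - l n) ^ 2) + (1 - l n) ^ 2 * ‖Complex.exp (Complex.I * t) - 1‖ := by
        rw [norm_mul, Complex.norm_real, Complex.norm_real, Real.norm_of_nonneg (by linarith),
          Real.norm_of_nonneg (by positivity)]
    _ ≤ 2 * l n + 1 * l k := by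
        have h2 : ‖Complex.exp (Complex.I * t) - 1‖ ≤ l k :=
          (Real.norm_exp_I_mul_ofReal_sub_one_le).trans (abs_cantorAngle_sub_le hl0 hl hkn h)
        gcongr
        nlinarith
    _ ≤ 3 * l k := by linarith

theorem card_filter_div_two_pow_eq {n j p : ℕ} (hj : j ≤ n) (hp : p < 2 ^ n) :
    ((Finset.range (2 ^ n)).filter fun q => p / 2 ^ j = q / 2 ^ j).card = 2 ^ j := by
  have : (Finset.range (2 ^ n)).filter (fun q => p / 2 ^ j = q / 2 ^ j)
      = Finset.Ico (p / 2 ^ j * 2 ^ j) ((p / 2 ^ j + 1) * 2 ^ j) := by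
    ext q
    have hpos : 0 < 2 ^ j := by positivity
    simp only [Finset.mem_filter, Finset.mem_range, Finset.mem_Ico]
    rw [← Nat.le_div_iff_mul_le hpos, ← Nat.div_lt_iff_lt_mul hpos]
    constructor
    · rintro ⟨-, h⟩; omega
    · rintro ⟨h1, h2⟩
      refine ⟨?_, by omega⟩
      have h3 : q / 2 ^ j < 2 ^ (n - j) := by
        have : p / 2 ^ j < 2 ^ (n - j) := by
          rw [Nat.div_lt_iff_lt_mul hpos, ← pow_add, Nat.sub_add_cancel hj]; exact hp
        omega
      rwa [Nat.div_lt_iff_lt_mul hpos, ← pow_add, Nat.sub_add_cancel hj] at h3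
  rw [this, Nat.card_Ico, add_mul, one_mul, Nat.add_sub_cancel_left]

/-- The logarithmic energy of the uniform probability measure on `w 0, …, w (N - 1)`. -/
def logEnergy (N : ℕ) (w : ℕ → ℂ) : ℝ :=
  (N : ℝ)⁻¹ ^ 2 * ∑ p ∈ Finset.range N, ∑ q ∈ Finset.range N,
    -Real.log ‖1 - starRingEnd ℂ (w q) * w p‖

theorem one_sub_conj_mul_ne_zero {w z : ℂ} (hw : ‖w‖ < 1) (hz : ‖z‖ ≤ 1) :
    1 - starRingEnd ℂ w * z ≠ 0 := by
  intro h
  have h1 : ‖starRingEnd ℂ w * z‖ = 1 := by rw [← sub_eq_zero.1 h, norm_one]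
  rw [norm_mul, RCLike.norm_conj] at h1
  nlinarith [norm_nonneg w, norm_nonneg z]

-- The sum telescopes along the common ancestors of `p` and `q`, so it records `log (1 / l k)` for
-- the last stage `k` at which they agree. This form can be averaged over pairs one stage at a time.
include hl0 hl in
theorem le_neg_log_norm_one_sub_conj_cantorPoint_mul {n p q : ℕ} (h1 : l n ≤ 1)
    (hp : p < 2 ^ n) (hq : q < 2 ^ n) :
    -Real.log 3 - Real.log (l 0) + ∑ k ∈ Finset.range n,
        (if p / 2 ^ (n - (k + 1)) = q / 2 ^ (n - (k + 1))
          then Real.log (l k) - Real.log (l (k + 1)) else 0) ≤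
      -Real.log ‖1 - starRingEnd ℂ (cantorPoint l n q) * cantorPoint l n p‖ := by
  set X := -Real.log ‖1 - starRingEnd ℂ (cantorPoint l n q) * cantorPoint l n p‖ with hX
  have hlt : ∀ p, ‖cantorPoint l n p‖ < 1 := fun p => by
    rw [norm_cantorPoint h1]; linarith [hl0 n]
  have key : ∀ k ≤ n, p / 2 ^ (n - k) = q / 2 ^ (n - k) →
      -Real.log 3 - Real.log (l k) ≤ X := by
    intro k hk h
    have := Real.log_le_log (norm_pos_iff.2 (one_sub_conj_mul_ne_zero (hlt q) (hlt p).le))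
      (norm_one_sub_conj_cantorPoint_mul_le hl0 hl hk h1 h)
    rw [Real.log_mul (by norm_num) (hl0 k).ne'] at this
    linarith
  have hdiff : ∀ k, 0 ≤ Real.log (l k) - Real.log (l (k + 1)) := fun k =>
    sub_nonneg.2 (Real.log_le_log (hl0 _) (antitone_of_halving hl0 hl k.le_succ))
  suffices H : ∀ m ≤ n, -Real.log 3 - Real.log (l 0) + ∑ k ∈ Finset.range m,
        (if p / 2 ^ (n - (k + 1)) = q / 2 ^ (n - (k + 1))
          then Real.log (l k) - Real.log (l (k + 1)) else 0) ≤ X from H n le_rfl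
  intro m
  induction m with
  | zero =>
    intro _
    simpa using key 0 (Nat.zero_le _) (by
      rw [Nat.sub_zero, Nat.div_eq_of_lt hp, Nat.div_eq_of_lt hq])
  | succ m ih =>
    intro hm
    -- If the ancestors agree at stage `m + 1`, keep every term and telescope; if not, the last term
    -- vanishes.
    by_cases h : p / 2 ^ (n - (m + 1)) = q / 2 ^ (n - (m + 1))
    · have h2 := key (m + 1) hm h
      have h3 : ∑ k ∈ Finset.range (m + 1), (if p / 2 ^ (n - (k + 1)) = q / 2 ^ (n - (k + 1))
          then Real.log (l k) - Real.log (l (k + 1)) else 0)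
          ≤ ∑ k ∈ Finset.range (m + 1), (Real.log (l k) - Real.log (l (k + 1))) :=
        Finset.sum_le_sum fun k _ => by
          split_ifs
          · exact le_rfl
          · exact hdiff k
      rw [Finset.sum_range_sub'] at h3
      linarith
    · rw [Finset.sum_range_succ, if_neg h, add_zero]
      exact ih (by omega)

-- Average the pairwise bound: a fraction `2⁻⁽ᵏ⁺¹⁾` of all pairs share their ancestor of stage `k +
-- 1`.
include hl0 hl in
theorem le_logEnergy_cantorPoint {n : ℕ} (h1 : l n ≤ 1) :
    -Real.log 3 - Real.log (l 0) + ∑ k ∈ Finset.range n,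
        (2⁻¹ : ℝ) ^ (k + 1) * (Real.log (l k) - Real.log (l (k + 1))) ≤
      logEnergy (2 ^ n) (cantorPoint l n) := by
  have hsum : ∀ k ∈ Finset.range n, ∑ p ∈ Finset.range (2 ^ n), ∑ q ∈ Finset.range (2 ^ n),
      (if p / 2 ^ (n - (k + 1)) = q / 2 ^ (n - (k + 1))
          then Real.log (l k) - Real.log (l (k + 1)) else 0)
      = ((2 : ℝ) ^ n) ^ 2 * ((2⁻¹ : ℝ) ^ (k + 1) * (Real.log (l k) - Real.log (l (k + 1)))) := by
    intro k hk
    have hk : k + 1 ≤ n := Finset.mem_range.1 hk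
    have : ∀ p ∈ Finset.range (2 ^ n), ∑ q ∈ Finset.range (2 ^ n),
      (if p / 2 ^ (n - (k + 1)) = q / 2 ^ (n - (k + 1))
          then Real.log (l k) - Real.log (l (k + 1)) else 0)
        = (2 : ℝ) ^ (n - (k + 1)) * (Real.log (l k) - Real.log (l (k + 1))) := by
      intro p hp
      rw [← Finset.sum_filter, Finset.sum_const,
        card_filter_div_two_pow_eq (Nat.sub_le _ _) (Finset.mem_range.1 hp), nsmul_eq_mul]
      push_cast; rfl
    rw [Finset.sum_congr rfl this, Finset.sum_const, Finset.card_range, nsmul_eq_mul]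
    obtain ⟨j, rfl⟩ := Nat.exists_eq_add_of_le hk
    rw [Nat.add_sub_cancel_left]
    push_cast
    rw [pow_add (2 : ℝ) (k + 1) j, inv_pow]
    field_simp
  have hle : ∑ p ∈ Finset.range (2 ^ n), ∑ q ∈ Finset.range (2 ^ n),
      (-Real.log 3 - Real.log (l 0) + ∑ k ∈ Finset.range n,
        (if p / 2 ^ (n - (k + 1)) = q / 2 ^ (n - (k + 1))
          then Real.log (l k) - Real.log (l (k + 1)) else 0)) ≤
      ∑ p ∈ Finset.range (2 ^ n), ∑ q ∈ Finset.range (2 ^ n),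
        -Real.log ‖1 - starRingEnd ℂ (cantorPoint l n q) * cantorPoint l n p‖ :=
    Finset.sum_le_sum fun p hp => Finset.sum_le_sum fun q hq =>
      le_neg_log_norm_one_sub_conj_cantorPoint_mul hl0 hl h1 (Finset.mem_range.1 hp)
        (Finset.mem_range.1 hq)
  simp only [Finset.sum_add_distrib, Finset.sum_const, Finset.card_range, nsmul_eq_mul] at hle
  have hswap : ∑ p ∈ Finset.range (2 ^ n), ∑ q ∈ Finset.range (2 ^ n), ∑ k ∈ Finset.range n,
        (if p / 2 ^ (n - (k + 1)) = q / 2 ^ (n - (k + 1))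
          then Real.log (l k) - Real.log (l (k + 1)) else 0)
      = ((2 : ℝ) ^ n) ^ 2 * ∑ k ∈ Finset.range n,
        (2⁻¹ : ℝ) ^ (k + 1) * (Real.log (l k) - Real.log (l (k + 1))) := by
    rw [Finset.mul_sum, ← Finset.sum_congr rfl hsum]
    exact (Finset.sum_congr rfl fun p _ => Finset.sum_comm).trans Finset.sum_comm
  rw [hswap] at hle
  rw [logEnergy, inv_pow, inv_mul_eq_div, le_div_iff₀ (by positivity)]
  refine le_trans (le_of_eq ?_) hle
  push_cast
  ring

end Cantor

/-! ### Reproducing property of the logarithmic kernel -/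

open MeasureTheory

/-- Polar coordinates in the unit disk. -/
theorem setIntegral_disk_eq_integral_circleMap {F : ℂ → ℂ}
    (hF : ContinuousOn F (Metric.closedBall 0 1)) :
    ∫ z in disk, F z =
      ∫ r in (0 : ℝ)..1, ∫ θ in (0 : ℝ)..2 * Real.pi, r • F (circleMap 0 r θ) := by
  have hsymm : ∀ p : ℝ × ℝ, Complex.polarCoord.symm p = circleMap 0 p.1 p.2 := fun p => by
    rw [Complex.polarCoord_symm_apply, circleMap, zero_add, Complex.exp_mul_I]
    push_cast; rfl
  have hmaps : Set.MapsTo (fun p : ℝ × ℝ => circleMap 0 p.1 p.2)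
      (Set.Icc 0 1 ×ˢ Set.Icc (-Real.pi) Real.pi) (Metric.closedBall 0 1) := by
    rintro ⟨r, θ⟩ ⟨hr, -⟩
    simpa [norm_circleMap_zero, abs_of_nonneg hr.1] using hr.2
  have hcont : ContinuousOn (fun p : ℝ × ℝ => p.1 • F (circleMap 0 p.1 p.2))
      (Set.Icc 0 1 ×ˢ Set.Icc (-Real.pi) Real.pi) := by
    refine continuousOn_fst.smul (hF.comp (Continuous.continuousOn ?_) hmaps)
    unfold circleMap
    fun_prop
  have hint : IntegrableOn (fun p : ℝ × ℝ => p.1 • F (circleMap 0 p.1 p.2))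
      (Set.Ioo 0 1 ×ˢ Set.Ioo (-Real.pi) Real.pi) :=
    (hcont.integrableOn_compact (isCompact_Icc.prod isCompact_Icc)).mono_set
      (Set.prod_mono Set.Ioo_subset_Icc_self Set.Ioo_subset_Icc_self)
  have hpolar : ∫ z in disk, F z = ∫ p in Set.Ioo 0 1 ×ˢ Set.Ioo (-Real.pi) Real.pi,
      p.1 • F (circleMap 0 p.1 p.2) := by
    rw [← integral_indicator (show MeasurableSet disk from measurableSet_ball),
      ← Complex.integral_comp_polarCoord_symm, polarCoord_target,
      setIntegral_eq_of_subset_of_forall_sdiff_eq_zero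
        (s := Set.Ioo (0 : ℝ) 1 ×ˢ Set.Ioo (-Real.pi) Real.pi)
        (measurableSet_Ioi.prod measurableSet_Ioo)
        (Set.prod_mono (fun x hx => hx.1) subset_rfl)]
    · refine setIntegral_congr_fun (measurableSet_Ioo.prod measurableSet_Ioo) ?_
      rintro ⟨r, θ⟩ ⟨hr, -⟩
      have : circleMap 0 r θ ∈ disk := by
        simpa [disk, norm_circleMap_zero, abs_of_pos hr.1] using hr.2
      simp only [hsymm, Set.indicator_of_mem this]
    · rintro ⟨r, θ⟩ ⟨⟨hr, hθ⟩, hn⟩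
      have hr0 : 0 < r := hr
      have : circleMap 0 r θ ∉ disk := by
        intro h
        refine hn ⟨⟨hr0, ?_⟩, hθ⟩
        simpa [disk, norm_circleMap_zero, abs_of_pos hr0] using h
      simp only [hsymm, Set.indicator_of_notMem this, smul_zero]
  rw [hpolar, Measure.volume_eq_prod, setIntegral_prod _ (by rwa [← Measure.volume_eq_prod]),
    intervalIntegral.integral_of_le zero_le_one, integral_Ioc_eq_integral_Ioo]
  refine setIntegral_congr_fun measurableSet_Ioo fun r _ => ?_
  have hper : Function.Periodic (fun θ => r • F (circleMap 0 r θ)) (2 * Real.pi) := fun θ => by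
    simp only [periodic_circleMap 0 r θ]
  have h := hper.intervalIntegral_add_eq (-Real.pi) 0
  rw [zero_add, show -Real.pi + 2 * Real.pi = Real.pi by ring] at h
  simp only []
  rw [← h, intervalIntegral.integral_of_le (by linarith [Real.pi_pos]),
    integral_Ioc_eq_integral_Ioo]

/-- The mean of `g` against the conjugate of the Szegő kernel over a circle. -/
theorem integral_circleMap_mul_conj_inv {g : ℂ → ℂ} {w : ℂ} {r : ℝ}
    (hg : DifferentiableOn ℂ g (Metric.closedBall 0 r)) (hr : 0 < r) (hw : ‖w‖ * r < 1) :
    ∫ θ in (0 : ℝ)..2 * Real.pi, g (circleMap 0 r θ) *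
        starRingEnd ℂ (1 - starRingEnd ℂ w * circleMap 0 r θ)⁻¹ =
      2 * Real.pi * g (r ^ 2 * w) := by
  have hmem : (r : ℂ) ^ 2 * w ∈ Metric.ball (0 : ℂ) r := by
    rw [mem_ball_zero_iff, norm_mul, norm_pow, Complex.norm_real, Real.norm_of_nonneg hr.le]
    nlinarith
  have h := hg.circleIntegral_sub_inv_smul hmem
  simp only [circleIntegral] at h
  -- On `|z| = r`, `z * conj z = r²` gives `z - r² w = z * conj (1 - conj w * z)`: the Cauchy kernel
  -- at `r² w` is a conjugate Szegő kernel.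
  have e : ∀ θ : ℝ, deriv (circleMap 0 r) θ •
      (circleMap 0 r θ - r ^ 2 * w)⁻¹ • g (circleMap 0 r θ) =
      Complex.I * (g (circleMap 0 r θ) *
        starRingEnd ℂ (1 - starRingEnd ℂ w * circleMap 0 r θ)⁻¹) := by
    intro θ
    set z := circleMap 0 r θ with hz
    have hzz : z * starRingEnd ℂ z = (r : ℂ) ^ 2 := by
      rw [Complex.mul_conj, Complex.normSq_eq_norm_sq, hz, norm_circleMap_zero, sq_abs]
      push_cast; rfl
    have hz0 : z ≠ 0 := circleMap_ne_center hr.ne'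
    have h1 : z - r ^ 2 * w = z * starRingEnd ℂ (1 - starRingEnd ℂ w * z) := by
      rw [← hzz]; simp; ring
    have h2 : starRingEnd ℂ (1 - starRingEnd ℂ w * z) ≠ 0 := by
      intro h0
      rw [h0, mul_zero, sub_eq_zero] at h1
      rw [← h1, mem_ball_zero_iff, hz, norm_circleMap_zero, abs_of_pos hr] at hmem
      exact lt_irrefl _ hmem
    rw [deriv_circleMap, h1, map_inv₀]
    simp only [smul_eq_mul, ← hz]
    field_simp
  simp only [e] at h
  rw [intervalIntegral.integral_const_mul, smul_eq_mul] at h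
  refine mul_left_cancel₀ Complex.I_ne_zero (h.trans ?_)
  ring

theorem continuousOn_inv_one_sub_conj_mul {w : ℂ} (hw : ‖w‖ < 1) :
    ContinuousOn (fun z => (1 - starRingEnd ℂ w * z)⁻¹) (Metric.closedBall 0 1) :=
  ContinuousOn.inv₀ (by fun_prop) fun z hz =>
    one_sub_conj_mul_ne_zero hw (by simpa using hz)

/-- The reproducing property of the logarithmic kernel in the Dirichlet space. -/
theorem setIntegral_disk_deriv_mul_conj {f g : ℂ → ℂ} {w : ℂ}
    (hf : ∀ z ∈ disk, HasDerivAt f (g z) z) (hgd : DifferentiableOn ℂ g disk)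
    (hg : ContinuousOn g (Metric.closedBall 0 1)) (hw : ‖w‖ < 1) :
    ∫ z in disk, g z * starRingEnd ℂ (starRingEnd ℂ w * (1 - starRingEnd ℂ w * z)⁻¹) =
      Real.pi * (f w - f 0) := by
  have hk : ContinuousOn (fun z => starRingEnd ℂ (starRingEnd ℂ w * (1 - starRingEnd ℂ w * z)⁻¹))
      (Metric.closedBall 0 1) :=
    Complex.continuous_conj.comp_continuousOn
      (continuousOn_const.mul (continuousOn_inv_one_sub_conj_mul hw))
  have hin : ∀ r ∈ Set.Icc (0 : ℝ) 1, (r : ℂ) ^ 2 * w ∈ disk := fun r hr => by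
    rw [disk, mem_ball_zero_iff, norm_mul, norm_pow, Complex.norm_real, Real.norm_of_nonneg hr.1]
    have := pow_le_one₀ (n := 2) hr.1 hr.2
    nlinarith [norm_nonneg w]
  rw [setIntegral_disk_eq_integral_circleMap (hg.fun_mul hk)]
  -- The angular integral is `π` times the `r`-derivative of `f (r² w)`, so the radial integral
  -- follows from the fundamental theorem of calculus.
  have hinner : ∀ r ∈ Set.Ioo (0 : ℝ) 1, ∫ θ in (0 : ℝ)..2 * Real.pi, r •
      (g (circleMap 0 r θ) * starRingEnd ℂ (starRingEnd ℂ w *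
        (1 - starRingEnd ℂ w * circleMap 0 r θ)⁻¹)) =
      Real.pi * (g (r ^ 2 * w) * (2 * r * w)) := by
    intro r hr
    have h := integral_circleMap_mul_conj_inv (g := g) (w := w) (r := r)
      (hgd.mono (Metric.closedBall_subset_ball hr.2)) hr.1 (by nlinarith [hr.1, hr.2])
    have e : ∀ θ : ℝ, r • (g (circleMap 0 r θ) * starRingEnd ℂ (starRingEnd ℂ w *
        (1 - starRingEnd ℂ w * circleMap 0 r θ)⁻¹)) = (r * w) * (g (circleMap 0 r θ) *
        starRingEnd ℂ (1 - starRingEnd ℂ w * circleMap 0 r θ)⁻¹) := fun θ => by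
      rw [map_mul, Complex.conj_conj, Complex.real_smul]; ring
    simp only [e, intervalIntegral.integral_const_mul, h]
    ring
  have hderiv : ∀ r ∈ Set.uIcc (0 : ℝ) 1,
      HasDerivAt (fun r : ℝ => f ((r : ℂ) ^ 2 * w)) (g (r ^ 2 * w) * (2 * r * w)) r := by
    intro r hr
    rw [Set.uIcc_of_le zero_le_one] at hr
    have h1 : HasDerivAt (fun z : ℂ => z ^ 2 * w) (2 * r * w) (r : ℂ) := by
      simpa using (hasDerivAt_pow 2 (r : ℂ)).mul_const w
    exact ((hf _ (hin r hr)).comp (r : ℂ) h1).comp_ofReal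
  have hii : IntervalIntegrable (fun r : ℝ => g ((r : ℂ) ^ 2 * w) * (2 * r * w)) volume 0 1 := by
    refine ContinuousOn.intervalIntegrable ?_
    rw [Set.uIcc_of_le zero_le_one]
    refine ContinuousOn.mul (hg.comp (by fun_prop) fun r hr => ?_) (by fun_prop)
    exact Metric.ball_subset_closedBall (hin r hr)
  have hmain : ∫ r in (0 : ℝ)..1, g ((r : ℂ) ^ 2 * w) * (2 * r * w) = f w - f 0 := by
    rw [intervalIntegral.integral_eq_sub_of_hasDerivAt hderiv hii]
    simp
  rw [← hmain, ← intervalIntegral.integral_const_mul, intervalIntegral.integral_of_le zero_le_one,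
    intervalIntegral.integral_of_le zero_le_one, integral_Ioc_eq_integral_Ioo,
    integral_Ioc_eq_integral_Ioo]
  exact setIntegral_congr_fun measurableSet_Ioo hinner

/-! ### Potentials as test functions -/

/-- The logarithmic potential of the uniform probability measure on `w 0, …, w (N - 1)`. -/
def logPotential (N : ℕ) (w : ℕ → ℂ) (z : ℂ) : ℂ :=
  (N : ℂ)⁻¹ * ∑ i ∈ Finset.range N, -Complex.log (1 - starRingEnd ℂ (w i) * z)

/-- The derivative of `logPotential N w` in the disk. -/
def logPotentialDeriv (N : ℕ) (w : ℕ → ℂ) (z : ℂ) : ℂ :=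
  (N : ℂ)⁻¹ * ∑ i ∈ Finset.range N, starRingEnd ℂ (w i) * (1 - starRingEnd ℂ (w i) * z)⁻¹

variable {N : ℕ} {w : ℕ → ℂ}

theorem logPotential_zero : logPotential N w 0 = 0 := by simp [logPotential]

theorem hasDerivAt_logPotential (hw : ∀ i, ‖w i‖ < 1) {z : ℂ} (hz : z ∈ disk) :
    HasDerivAt (logPotential N w) (logPotentialDeriv N w z) z := by
  refine HasDerivAt.const_mul _ (HasDerivAt.fun_sum fun i _ => ?_)
  have h1 : HasDerivAt (fun z => 1 - starRingEnd ℂ (w i) * z) (-starRingEnd ℂ (w i)) z := by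
    simpa using ((hasDerivAt_id z).const_mul (starRingEnd ℂ (w i))).const_sub 1
  have hz1 : ‖z‖ < 1 := by simpa [disk] using hz
  have h2 : 1 - starRingEnd ℂ (w i) * z ∈ Complex.slitPlane := by
    have : ‖-(starRingEnd ℂ (w i) * z)‖ < 1 := by
      rw [norm_neg, norm_mul, RCLike.norm_conj]
      nlinarith [norm_nonneg (w i), norm_nonneg z, hw i]
    simpa [sub_eq_add_neg] using Complex.mem_slitPlane_of_norm_lt_one this
  simpa [div_eq_mul_inv] using (h1.clog h2).fun_neg

theorem continuousOn_logPotentialDeriv (hw : ∀ i, ‖w i‖ < 1) :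
    ContinuousOn (logPotentialDeriv N w) (Metric.closedBall 0 1) :=
  continuousOn_const.mul (continuousOn_finsetSum _ fun i _ =>
    continuousOn_const.mul (continuousOn_inv_one_sub_conj_mul (hw i)))

theorem differentiableOn_logPotentialDeriv (hw : ∀ i, ‖w i‖ < 1) :
    DifferentiableOn ℂ (logPotentialDeriv N w) disk := by
  refine DifferentiableOn.const_mul (DifferentiableOn.fun_sum fun i _ =>
    DifferentiableOn.const_mul (DifferentiableOn.inv (by fun_prop) fun z hz => ?_) _) _
  have hz1 : ‖z‖ < 1 := by simpa [disk] using hz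
  exact one_sub_conj_mul_ne_zero (hw i) hz1.le

/-- The derivative `g` is a mean of kernels, so the reproducing property applied to each conjugate
kernel turns `∫ g * conj g` into `π` times the mean of the potential over the `w i`. -/
theorem dirichletIntegral_logPotential_eq (hw : ∀ i, ‖w i‖ < 1) :
    dirichletIntegral (logPotential N w) =
      ENNReal.ofReal ((N : ℝ)⁻¹ * ∑ i ∈ Finset.range N, (logPotential N w (w i)).re) := by
  set g := logPotentialDeriv N w with hg
  have hgc := continuousOn_logPotentialDeriv (N := N) hw
  have hdisk : disk ⊆ Metric.closedBall (0 : ℂ) 1 := Metric.ball_subset_closedBall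
  have hmeas : MeasurableSet disk := measurableSet_ball
  have hcomp : ∫ z in disk, g z * starRingEnd ℂ (g z) =
      (N : ℂ)⁻¹ * ∑ i ∈ Finset.range N, Real.pi * logPotential N w (w i) := by
    have e : ∀ z, g z * starRingEnd ℂ (g z) = (N : ℂ)⁻¹ * ∑ i ∈ Finset.range N,
        g z * starRingEnd ℂ (starRingEnd ℂ (w i) * (1 - starRingEnd ℂ (w i) * z)⁻¹) := fun z => by
      conv_lhs => rw [hg, logPotentialDeriv, map_mul, map_sum, ← logPotentialDeriv, ← hg]
      rw [map_inv₀, Complex.conj_natCast, mul_left_comm, Finset.mul_sum]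
    simp only [e]
    rw [integral_const_mul, integral_finsetSum]
    · congr 1
      refine Finset.sum_congr rfl fun i _ => ?_
      rw [setIntegral_disk_deriv_mul_conj (f := logPotential N w)
        (fun z hz => hasDerivAt_logPotential hw hz) (differentiableOn_logPotentialDeriv hw) hgc
        (hw i), logPotential_zero, sub_zero]
    · intro i _
      refine IntegrableOn.mono_set (ContinuousOn.integrableOn_compact
        (isCompact_closedBall (0 : ℂ) 1) (hgc.mul ?_)) hdisk
      exact Complex.continuous_conj.comp_continuousOn
        (continuousOn_const.mul (continuousOn_inv_one_sub_conj_mul (hw i)))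
  have hreal : ∫ z in disk, ‖g z‖ ^ 2 =
      Real.pi * ((N : ℝ)⁻¹ * ∑ i ∈ Finset.range N, (logPotential N w (w i)).re) := by
    have h1 : ((∫ z in disk, ‖g z‖ ^ 2 : ℝ) : ℂ) = ∫ z in disk, g z * starRingEnd ℂ (g z) := by
      rw [← integral_complex_ofReal]
      refine integral_congr_ae (Filter.Eventually.of_forall fun z => ?_)
      simp only [Complex.mul_conj, Complex.normSq_eq_norm_sq]
    rw [hcomp, ← Finset.mul_sum] at h1
    have h2 := congrArg Complex.re h1
    rw [Complex.ofReal_re, ← Complex.ofReal_natCast, ← Complex.ofReal_inv, Complex.re_ofReal_mul,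
      Complex.re_ofReal_mul, Complex.re_sum] at h2
    rw [h2]; ring
  have hint : IntegrableOn (fun z => ‖g z‖ ^ 2) disk :=
    (ContinuousOn.integrableOn_compact (isCompact_closedBall (0 : ℂ) 1) (hgc.norm.pow 2)).mono_set
      hdisk
  have hlint : ∫⁻ z in disk, ‖deriv (logPotential N w) z‖ₑ ^ 2 =
      ENNReal.ofReal (∫ z in disk, ‖g z‖ ^ 2) := by
    rw [ofReal_integral_eq_lintegral_ofReal hint
      (Filter.Eventually.of_forall fun z => by positivity)]
    refine setLIntegral_congr_fun hmeas fun z hz => ?_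
    simp only [(hasDerivAt_logPotential hw hz).deriv]
    rw [ENNReal.ofReal_pow (norm_nonneg _), ofReal_norm]
  rw [dirichletIntegral, hlint, hreal, ← ENNReal.ofReal_mul (by positivity)]
  congr 1
  field_simp

theorem logEnergy_eq (N : ℕ) (w : ℕ → ℂ) :
    (N : ℝ)⁻¹ * ∑ i ∈ Finset.range N, (logPotential N w (w i)).re = logEnergy N w := by
  have : ∀ i, (logPotential N w (w i)).re = (N : ℝ)⁻¹ * ∑ j ∈ Finset.range N,
      -Real.log ‖1 - starRingEnd ℂ (w j) * w i‖ := fun i => by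
    rw [logPotential, ← Complex.ofReal_natCast, ← Complex.ofReal_inv, Complex.re_ofReal_mul,
      Complex.re_sum]
    simp only [Complex.neg_re, Complex.log_re]
  simp only [this]
  rw [← Finset.mul_sum, logEnergy, sq, mul_assoc]

/-- The uniform probability measure on `w 0, …, w (N - 1)`. -/
def uniformMeasure (N : ℕ) (w : ℕ → ℂ) : Measure ℂ :=
  (N : ℝ≥0∞)⁻¹ • ∑ i ∈ Finset.range N, Measure.dirac (w i)

/-- A multiple of a uniform measure below a Carleson measure has controlled logarithmic energy. -/
theorem mul_logEnergy_le_of_smul_uniformMeasure_le (hw : ∀ i, ‖w i‖ < 1) {μ : Measure ℂ} {a C : ℝ≥0}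
    (hμ : (a : ℝ≥0∞) • uniformMeasure N w ≤ μ)
    (hC : ∀ f : ℂ → ℂ, MemDirichlet f → ∫⁻ z in disk, ‖f z‖ₑ ^ 2 ∂μ ≤ C * dirichletNormSq f) :
    a * logEnergy N w ≤ C := by
  set E := logEnergy N w with hE
  set f := logPotential N w with hf
  rcases le_or_gt E 0 with hE0 | hE0
  · exact (mul_nonpos_of_nonneg_of_nonpos a.2 hE0).trans C.2
  have hN : 0 < N := by
    rcases Nat.eq_zero_or_pos N with rfl | h
    · simp [hE, logEnergy] at hE0
    · exact h
  have hD : dirichletIntegral f = ENNReal.ofReal E := by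
    rw [hf, dirichletIntegral_logPotential_eq hw, logEnergy_eq]
  have hmem : MemDirichlet f :=
    ⟨fun z hz => (hasDerivAt_logPotential hw hz).differentiableAt.differentiableWithinAt,
      hD ▸ ENNReal.ofReal_lt_top⟩
  have hnorm : dirichletNormSq f = ENNReal.ofReal E := by
    rw [dirichletNormSq, hD, hf, logPotential_zero]; simp
  -- Cauchy–Schwarz, since `E` is the mean of `(f (w i)).re`.
  have hsq : E ^ 2 ≤ (N : ℝ)⁻¹ * ∑ i ∈ Finset.range N, ‖f (w i)‖ ^ 2 := by
    have h1 := sq_sum_le_card_mul_sum_sq (s := Finset.range N) (f := fun i => (f (w i)).re)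
    have h2 : ∑ i ∈ Finset.range N, (f (w i)).re ^ 2 ≤ ∑ i ∈ Finset.range N, ‖f (w i)‖ ^ 2 :=
      Finset.sum_le_sum fun i _ => sq_le_sq' (neg_le_of_abs_le (Complex.abs_re_le_norm _))
        (Complex.re_le_norm _)
    rw [Finset.card_range] at h1
    rw [hE, ← logEnergy_eq, mul_pow, sq (N : ℝ)⁻¹, mul_assoc]
    have hN' : (0 : ℝ) < N := by exact_mod_cast hN
    gcongr
    rw [inv_mul_le_iff₀ hN']
    exact h1.trans (by gcongr)
  have hlow : (a : ℝ≥0∞) * ENNReal.ofReal (E ^ 2) ≤ ∫⁻ z in disk, ‖f z‖ₑ ^ 2 ∂μ := by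
    refine le_trans ?_ (lintegral_mono' (Measure.restrict_mono le_rfl hμ) le_rfl)
    rw [← lintegral_indicator (show MeasurableSet disk from measurableSet_ball),
      lintegral_smul_measure, smul_eq_mul]
    gcongr
    rw [uniformMeasure, lintegral_smul_measure, smul_eq_mul, lintegral_finsetSum_measure]
    have : ∀ i ∈ Finset.range N,
        ∫⁻ z, disk.indicator (fun z => ‖f z‖ₑ ^ 2) z ∂Measure.dirac (w i) =
        ENNReal.ofReal (‖f (w i)‖ ^ 2) := fun i _ => by
      have hi : w i ∈ disk := by simpa [disk] using hw i
      rw [lintegral_dirac, Set.indicator_of_mem hi, ENNReal.ofReal_pow (norm_nonneg _), ofReal_norm]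
    rw [Finset.sum_congr rfl this, ← ENNReal.ofReal_sum_of_nonneg (fun i _ => by positivity),
      ← ENNReal.ofReal_natCast, ← ENNReal.ofReal_inv_of_pos (by exact_mod_cast hN),
      ← ENNReal.ofReal_mul (by positivity)]
    exact ENNReal.ofReal_le_ofReal hsq
  have hfin := hlow.trans (hC f hmem)
  rw [hnorm, ← ENNReal.ofReal_coe_nnreal (p := a), ← ENNReal.ofReal_coe_nnreal (p := C),
    ← ENNReal.ofReal_mul a.coe_nonneg, ← ENNReal.ofReal_mul C.coe_nonneg,
    ENNReal.ofReal_le_ofReal_iff (by positivity)] at hfin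
  -- Now `a * E² ≤ C * E`; cancel one factor `E`.
  rw [sq, ← mul_assoc] at hfin
  exact le_of_mul_le_mul_right hfin hE0
-- Scales adapted to `φ`
section Scales

variable {φ : ℝ → ℝ}

theorem setLIntegral_div_le_of_monotoneOn {a b : ℝ} (ha : 0 < a) (hab : a ≤ b) (hb : b ≤ 2 * Real.pi)
    (hpos : ∀ x ∈ Set.Ioc 0 (2 * Real.pi), 0 < φ x)
    (hmono : MonotoneOn φ (Set.Ioc 0 (2 * Real.pi))) :
    ∫⁻ x in Set.Ioc a b, ENNReal.ofReal (φ x / x) ≤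
      ENNReal.ofReal (φ b * (Real.log b - Real.log a)) := by
  have hb0 : 0 < b := ha.trans_le hab
  have h0 : (0 : ℝ) ∉ Set.uIcc a b := by
    rw [Set.uIcc_of_le hab]; exact fun h => ha.not_ge h.1
  have hii : IntervalIntegrable (fun x : ℝ => φ b * x⁻¹) volume a b :=
    (intervalIntegral.intervalIntegrable_inv (fun x hx h => h0 (h ▸ hx)) continuousOn_id).const_mul _
  have hval : ∫ x in Set.Ioc a b, φ b * x⁻¹ = φ b * (Real.log b - Real.log a) := by
    rw [← intervalIntegral.integral_of_le hab, intervalIntegral.integral_const_mul,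
      integral_inv h0, Real.log_div hb0.ne' ha.ne']
  rw [← hval, ofReal_integral_eq_lintegral_ofReal
    ((intervalIntegrable_iff_integrableOn_Ioc_of_le hab).1 hii)]
  · refine setLIntegral_mono' measurableSet_Ioc fun x hx => ENNReal.ofReal_le_ofReal ?_
    have hx0 : 0 < x := ha.trans hx.1
    rw [div_eq_mul_inv]
    gcongr
    exact hmono ⟨hx0, hx.2.trans hb⟩ ⟨hb0, hb⟩ hx.2
  · refine (ae_restrict_iff' measurableSet_Ioc).2 (Filter.Eventually.of_forall fun x hx => ?_)
    have := hpos b ⟨hb0, hb⟩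
    have hx0 : 0 < x := ha.trans hx.1
    simp only [Pi.zero_apply]
    positivity

/-- If `φ` tends to `0`, there are scales at which `φ` is successively halved. -/
theorem exists_halving_seq
    (hpos : ∀ x ∈ Set.Ioc 0 (2 * Real.pi), 0 < φ x)
    (hcont : ContinuousOn φ (Set.Ioc 0 (2 * Real.pi)))
    (hmono : MonotoneOn φ (Set.Ioc 0 (2 * Real.pi)))
    (hanti : StrictAntiOn (fun x : ℝ => φ x / x) (Set.Ioc 0 (2 * Real.pi)))
    (hsmall : ∀ c > 0, ∃ x ∈ Set.Ioc 0 (2 * Real.pi), φ x < c)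
    {b : ℝ} (hb : b ∈ Set.Ioc 0 (2 * Real.pi)) :
    ∃ l : ℕ → ℝ, l 0 = b ∧ (∀ k, 0 < l k) ∧ (∀ k, 2 * l (k + 1) ≤ l k) ∧
      ∀ k, φ (l k) = φ b * 2⁻¹ ^ k := by
  have step : ∀ x : Set.Ioc 0 (2 * Real.pi), ∃ y : Set.Ioc 0 (2 * Real.pi),
      2 * (y : ℝ) ≤ x ∧ φ y = φ x * 2⁻¹ := by
    rintro ⟨x, hx⟩
    have hφx := hpos x hx
    obtain ⟨u, hu, hux⟩ := hsmall (φ x * 2⁻¹) (by positivity)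
    have hlt : u < x := by
      by_contra! h
      have := hmono hx hu h
      linarith
    have hsub : Set.Icc u x ⊆ Set.Ioc 0 (2 * Real.pi) := fun y hy =>
      ⟨hu.1.trans_le hy.1, hy.2.trans hx.2⟩
    obtain ⟨y, hy, hyx⟩ := intermediate_value_Icc hlt.le (hcont.mono hsub)
      (show φ x * 2⁻¹ ∈ Set.Icc (φ u) (φ x) from ⟨hux.le, by linarith⟩)
    refine ⟨⟨y, hsub hy⟩, ?_, hyx⟩
    -- If `y > x / 2`, then `φ y ≥ φ (x / 2) > φ x / 2`, the last inequality because `φ x / x` is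
    -- strictly decreasing.
    by_contra! hlt2
    have hhalf : x / 2 ∈ Set.Ioc 0 (2 * Real.pi) :=
      ⟨by linarith [hx.1], by linarith [hx.1, hx.2]⟩
    have h1 := hmono hhalf (hsub hy) (by simp only at hlt2; linarith)
    have h2 : φ x / x < φ (x / 2) / (x / 2) := hanti hhalf hx (by linarith [hx.1])
    rw [div_lt_div_iff₀ hx.1 hhalf.1] at h2
    have h3 : φ x / 2 < φ (x / 2) := by
      have := hx.1
      nlinarith
    linarith
  choose next hnext using step
  let s : ℕ → Set.Ioc 0 (2 * Real.pi) := fun k => next^[k] ⟨b, hb⟩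
  have hs : ∀ k, s (k + 1) = next (s k) := fun k => Function.iterate_succ_apply' _ _ _
  refine ⟨fun k => s k, rfl, fun k => (s k).2.1, fun k => ?_, fun k => ?_⟩
  · simp only [hs]; exact (hnext _).1
  · induction k with
    | zero => simp [s]
    | succ k ih => simp only [hs] at ih ⊢; rw [(hnext _).2, ih, pow_succ, mul_assoc]

/-- If `φ` tends to `0`, halving scales work with `c = φ (1 / 2)`: bounded energy sums would make
the integral finite. Otherwise `φ` has a positive lower bound `c`, and one point close to the circle
suffices. -/
theorem exists_scales
    (hpos : ∀ x ∈ Set.Ioc 0 (2 * Real.pi), 0 < φ x)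
    (hcont : ContinuousOn φ (Set.Ioc 0 (2 * Real.pi)))
    (hmono : MonotoneOn φ (Set.Ioc 0 (2 * Real.pi)))
    (hanti : StrictAntiOn (fun x : ℝ => φ x / x) (Set.Ioc 0 (2 * Real.pi)))
    (hint : ∫⁻ x in Set.Ioc 0 (2 * Real.pi), ENNReal.ofReal (φ x / x) = ∞) :
    ∃ c > 0, ∀ M : ℝ, ∃ (n : ℕ) (l : ℕ → ℝ), (∀ k, 0 < l k) ∧ (∀ k, 2 * l (k + 1) ≤ l k) ∧
      l 0 ≤ 1 / 2 ∧ (∀ k ≤ n, c * 2⁻¹ ^ k ≤ φ (l k)) ∧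
      M ≤ -Real.log 3 - Real.log (l 0) + ∑ k ∈ Finset.range n,
        (2⁻¹ : ℝ) ^ (k + 1) * (Real.log (l k) - Real.log (l (k + 1))) := by
  have hpi := Real.pi_gt_three
  by_cases hsmall : ∀ c > 0, ∃ x ∈ Set.Ioc 0 (2 * Real.pi), φ x < c
  · have hb : (1 / 2 : ℝ) ∈ Set.Ioc 0 (2 * Real.pi) := ⟨by norm_num, by linarith⟩
    obtain ⟨l, hlb, hl0, hl, hφl⟩ := exists_halving_seq hpos hcont hmono hanti hsmall hb
    have hc := hpos _ hb
    set c := φ (1 / 2) with hcdef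
    refine ⟨c, hc, fun M => ?_⟩
    by_contra! hcon
    have hlt : ∀ n, ∑ k ∈ Finset.range n,
        (2⁻¹ : ℝ) ^ (k + 1) * (Real.log (l k) - Real.log (l (k + 1))) <
        M + Real.log 3 + Real.log (1 / 2) := fun n => by
      have := hcon n l hl0 hl hlb.le fun k _ => (hφl k).ge
      rw [hlb] at this
      linarith
    have hanti_l := antitone_of_halving hl0 hl
    -- On `(l (k + 1), l k]`, `φ ≤ φ (l k) = c * 2⁻ᵏ`; the factor `2` turns `2⁻⁽ᵏ⁺¹⁾` into `2⁻ᵏ`.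
    have hle : ∀ n, ∫⁻ x in Set.Ioc (l n) (1 / 2), ENNReal.ofReal (φ x / x) ≤
        ENNReal.ofReal (2 * c * ∑ k ∈ Finset.range n,
          (2⁻¹ : ℝ) ^ (k + 1) * (Real.log (l k) - Real.log (l (k + 1)))) := by
      have hterm : ∀ k, 0 ≤ (2⁻¹ : ℝ) ^ (k + 1) * (Real.log (l k) - Real.log (l (k + 1))) :=
        fun k => mul_nonneg (by positivity)
          (sub_nonneg.2 (Real.log_le_log (hl0 _) (hanti_l k.le_succ)))
      intro n
      induction n with
      | zero => simp [hlb]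
      | succ n ih =>
        have hn2 : l n ≤ 1 / 2 := hlb ▸ hanti_l (Nat.zero_le n)
        rw [← Set.Ioc_union_Ioc_eq_Ioc (hanti_l n.le_succ) hn2, Finset.sum_range_succ, mul_add,
          ENNReal.ofReal_add (mul_nonneg (by positivity) (Finset.sum_nonneg fun k _ => hterm k))
            (mul_nonneg (by positivity) (hterm n)), add_comm (ENNReal.ofReal _)]
        refine (lintegral_union_le _ _ _).trans (add_le_add ?_ ih)
        refine (setLIntegral_div_le_of_monotoneOn (hl0 _) (hanti_l n.le_succ)
          (hn2.trans hb.2) hpos hmono).trans (ENNReal.ofReal_le_ofReal (le_of_eq ?_))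
        rw [hφl, pow_succ]
        ring
    have hunion : Set.Ioc (0 : ℝ) (1 / 2) = ⋃ n, Set.Ioc (l n) (1 / 2) := by
      have hpow : ∀ n, l n ≤ (1 / 2) * 2⁻¹ ^ n := fun n => by
        induction n with
        | zero => simp [hlb]
        | succ n ih => rw [pow_succ]; linarith [hl n]
      ext x
      simp only [Set.mem_Ioc, Set.mem_iUnion]
      constructor
      · rintro ⟨h1, h2⟩
        obtain ⟨n, hn⟩ := exists_pow_lt_of_lt_one h1 (show (2⁻¹ : ℝ) < 1 by norm_num)
        refine ⟨n, (hpow n).trans_lt ?_, h2⟩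
        have : (0 : ℝ) < 2⁻¹ ^ n := by positivity
        linarith
      · rintro ⟨n, h1, h2⟩
        exact ⟨(hl0 n).trans h1, h2⟩
    have hbound : ∫⁻ x in Set.Ioc 0 (1 / 2), ENNReal.ofReal (φ x / x) ≤
        ENNReal.ofReal (2 * c * (M + Real.log 3 + Real.log (1 / 2))) := by
      rw [hunion, setLIntegral_iUnion_of_directed]
      · refine iSup_le fun n => (hle n).trans (ENNReal.ofReal_le_ofReal ?_)
        gcongr
        exact (hlt n).le
      · exact directed_of_isDirected_le fun m n hmn =>
          Set.Ioc_subset_Ioc_left (hanti_l hmn)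
    have hfin : ∫⁻ x in Set.Ioc 0 (2 * Real.pi), ENNReal.ofReal (φ x / x) < ∞ := by
      rw [← Set.Ioc_union_Ioc_eq_Ioc hb.1.le hb.2]
      refine (lintegral_union_le _ _ _).trans_lt (ENNReal.add_lt_top.2
        ⟨hbound.trans_lt ENNReal.ofReal_lt_top, ?_⟩)
      exact (setLIntegral_div_le_of_monotoneOn hb.1 hb.2 le_rfl hpos hmono).trans_lt
        ENNReal.ofReal_lt_top
    exact hfin.ne hint
  · push Not at hsmall
    obtain ⟨c, hc, hcφ⟩ := hsmall
    refine ⟨c, hc, fun M => ?_⟩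
    -- With `n = 0` the energy bound is `-log 3 - log ε`, and this choice makes it at least `M`.
    set ε := min (1 / 2) (Real.exp (-Real.log 3 - M)) with hε
    have hε0 : 0 < ε := lt_min (by norm_num) (Real.exp_pos _)
    refine ⟨0, fun k => ε * 2⁻¹ ^ k, fun k => by positivity, fun k => ?_, ?_, ?_, ?_⟩
    · simp only [pow_succ]; exact le_of_eq (by ring)
    · simp only [pow_zero, mul_one]; exact min_le_left _ _
    · intro k hk
      obtain rfl : k = 0 := by omega
      have : ε ≤ 1 / 2 := min_le_left _ _
      simpa using hcφ ε ⟨hε0, by linarith⟩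
    · have : Real.log ε ≤ -Real.log 3 - M := by
        rw [Real.log_le_iff_le_exp hε0]; exact min_le_right _ _
      simp only [pow_zero, mul_one, Finset.range_zero, Finset.sum_empty, add_zero]
      linarith

end Scales
-- One-box estimates
theorem uniformMeasure_apply {N : ℕ} (hN : 0 < N) (w : ℕ → ℂ) (S : Set ℂ)
    [DecidablePred fun i => w i ∈ S] :
    uniformMeasure N w S =
      ENNReal.ofReal (((Finset.range N).filter fun i => w i ∈ S).card / N) := by
  rw [uniformMeasure, Measure.smul_apply, Measure.finsetSum_apply, smul_eq_mul]
  simp only [Measure.dirac_apply, Set.indicator_apply, Pi.one_apply]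
  rw [Finset.sum_boole, ENNReal.ofReal_div_of_pos (by exact_mod_cast hN), ENNReal.ofReal_natCast,
    ENNReal.ofReal_natCast, ENNReal.div_eq_inv_mul]

theorem uniformMeasure_apply_le_one (N : ℕ) (w : ℕ → ℂ) (S : Set ℂ) :
    uniformMeasure N w S ≤ 1 := by
  classical
  rcases Nat.eq_zero_or_pos N with rfl | hN
  · simp [uniformMeasure]
  rw [uniformMeasure_apply hN, ENNReal.ofReal_le_one]
  refine div_le_one_of_le₀ ?_ (Nat.cast_nonneg _)
  exact_mod_cast (Finset.card_filter_le _ _).trans (Finset.card_range N).le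

/-- Nearby angles of points of a short arc differ by at most the length of the arc. -/
theorem IsArc.abs_sub_le {I : Set ℂ} {ℓ s t : ℝ} (hI : IsArc I ℓ) (hℓ : ℓ < 1)
    (hs : s ∈ Set.Icc (0 : ℝ) 1) (ht : t ∈ Set.Icc (0 : ℝ) 1)
    (hsI : Complex.exp (s * Complex.I) ∈ I) (htI : Complex.exp (t * Complex.I) ∈ I) :
    |s - t| ≤ ℓ := by
  obtain ⟨a, b, -, -, rfl, -, hsub⟩ := hI
  have lift : ∀ x : ℝ, Complex.exp (x * Complex.I) ∈ I →
      ∃ y ∈ Set.Icc a b, ∃ m : ℤ, x = y + m * (2 * Real.pi) := by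
    intro x hx
    obtain ⟨y, hy, hyx⟩ := hsub hx
    obtain ⟨m, hm⟩ := Complex.exp_eq_exp_iff_exists_int.1 hyx.symm
    refine ⟨y, hy, m, ?_⟩
    have : (x : ℂ) * Complex.I = ((y + m * (2 * Real.pi) : ℝ) : ℂ) * Complex.I := by
      rw [hm]; push_cast; ring
    exact_mod_cast mul_right_cancel₀ Complex.I_ne_zero this
  obtain ⟨x, hx, m, rfl⟩ := lift s hsI
  obtain ⟨y, hy, k, rfl⟩ := lift t htI
  have hpi := Real.pi_gt_three
  -- Distinct sheets would differ by at least `2π`, but `s`, `t` and `x`, `y` each differ by at most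
  -- `1`.
  have hmk : m = k := by
    by_contra hne
    have h1 : (1 : ℝ) ≤ |(m : ℝ) - k| := by
      exact_mod_cast Int.one_le_abs (sub_ne_zero.2 hne)
    have h2 : |((m : ℝ) - k) * (2 * Real.pi)| ≤ 2 := by
      rw [abs_le]
      constructor <;> linarith [hx.1, hx.2, hy.1, hy.2, hs.1, hs.2, ht.1, ht.2]
    rw [abs_mul, abs_of_pos (by linarith : (0 : ℝ) < 2 * Real.pi)] at h2
    nlinarith
  subst hmk
  rw [abs_le]
  constructor <;> linarith [hx.1, hx.2, hy.1, hy.2]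

/-- A uniform one-box estimate for the uniform measures of a Cantor construction. -/
theorem uniformMeasure_cantorPoint_carlesonBox_le {φ : ℝ → ℝ}
    (hmono : MonotoneOn φ (Set.Ioc 0 (2 * Real.pi))) {c : ℝ} (hc : 0 < c) {l : ℕ → ℝ}
    (hl0 : ∀ k, 0 < l k) (hl : ∀ k, 2 * l (k + 1) ≤ l k) (hlb : l 0 ≤ 1 / 2) {n : ℕ}
    (hφ : ∀ k ≤ n, c * 2⁻¹ ^ k ≤ φ (l k)) {I : Set ℂ} {ℓ : ℝ} (hI : IsArc I ℓ) (hℓ : ℓ < 1) :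
    uniformMeasure (2 ^ n) (cantorPoint l n) (carlesonBox I ℓ) ≤
      ENNReal.ofReal (2 / c * φ ℓ) := by
  classical
  have hpi := Real.pi_gt_three
  have hanti := antitone_of_halving hl0 hl
  rw [uniformMeasure_apply (by positivity)]
  set F := (Finset.range (2 ^ n)).filter fun p => cantorPoint l n p ∈ carlesonBox I ℓ with hF
  rcases F.eq_empty_or_nonempty with h0 | ⟨p₀, hp₀⟩
  · simp [h0]
  have hbox : ∀ p ∈ F, l n < ℓ ∧ Complex.exp (cantorAngle l n p * Complex.I) ∈ I := by
    intro p hp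
    obtain ⟨r, ζ, hr0, hrℓ, -, hζ, hz⟩ := (Finset.mem_filter.1 hp).2
    obtain ⟨a, b, -, -, -, -, hsub⟩ := hI
    have hζ1 : ‖ζ‖ = 1 := by
      obtain ⟨t, -, rfl⟩ := hsub hζ
      exact Complex.norm_exp_ofReal_mul_I t
    have hln := hanti (Nat.zero_le n)
    have hr : 1 - l n = r := by
      rw [← norm_cantorPoint (l := l) (n := n) (by linarith) p, hz, norm_mul, hζ1, mul_one,
        Complex.norm_real, Real.norm_of_nonneg hr0]
    refine ⟨by linarith, ?_⟩
    rw [cantorPoint, hr] at hz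
    have hr' : (r : ℂ) ≠ 0 := by
      rw [Complex.ofReal_ne_zero, ← hr]; linarith
    rwa [mul_left_cancel₀ hr' hz]
  have hangle : ∀ p ∈ F, cantorAngle l n p ∈ Set.Icc (0 : ℝ) 1 := by
    intro p hp
    have h := cantorAngle_mem_ancestor hl0 hl 0 n p
    rw [Nat.div_eq_of_lt (Finset.mem_range.1 (Finset.mem_filter.1 hp).1), zero_add] at h
    have := hl0 n
    simp only [cantorAngle, Nat.cast_zero, zero_mul] at h
    exact ⟨h.1, by linarith [h.2]⟩
  have hnℓ : l n < ℓ := (hbox p₀ hp₀).1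
  have hℓ0 : 0 < ℓ := (hl0 n).trans hnℓ
  have hφle : ∀ k ≤ n, l k ≤ ℓ → c * 2⁻¹ ^ k ≤ φ ℓ := fun k hk hkℓ =>
    (hφ k hk).trans (hmono ⟨hl0 k, by linarith⟩ ⟨hℓ0, by linarith⟩ hkℓ)
  refine ENNReal.ofReal_le_ofReal ?_
  -- Take the first scale `l (k + 1) ≤ ℓ`. As `ℓ < l k`, the box has mass at most `2⁻ᵏ = 2 * 2⁻⁽ᵏ⁺¹⁾
  -- ≤ (2 / c) * φ ℓ`. If already `l 0 ≤ ℓ`, total mass `1` is enough.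
  have hex : ∃ k, l k ≤ ℓ := ⟨n, hnℓ.le⟩
  rw [div_mul_eq_mul_div, le_div_iff₀ hc]
  rcases hfind : Nat.find hex with _ | k
  · have h1 : l 0 ≤ ℓ := hfind ▸ Nat.find_spec hex
    have h2 := hφle 0 (Nat.zero_le _) h1
    have h3 : (F.card : ℝ) / (2 ^ n : ℕ) ≤ 1 := by
      refine div_le_one_of_le₀ ?_ (Nat.cast_nonneg _)
      exact_mod_cast (Finset.card_filter_le _ _).trans (Finset.card_range _).le
    rw [pow_zero, mul_one] at h2
    nlinarith
  · have h1 : l (k + 1) ≤ ℓ := hfind ▸ Nat.find_spec hex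
    have hkn : k + 1 ≤ n := hfind ▸ Nat.find_min' hex hnℓ.le
    have hkℓ : ℓ < l k := not_le.1 (Nat.find_min hex (hfind ▸ k.lt_succ_self))
    have h2 := hφle (k + 1) hkn h1
    have hcard : F.card ≤ 2 ^ (n - k) :=
      card_le_of_abs_cantorAngle_sub_lt hl0 hl (by omega) F fun p hp q hq =>
        (hI.abs_sub_le hℓ (hangle p hp) (hangle q hq) (hbox p hp).2 (hbox q hq).2).trans_lt hkℓ
    have h3 : (F.card : ℝ) / (2 ^ n : ℕ) ≤ 2⁻¹ ^ k := by
      rw [div_le_iff₀ (by positivity)]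
      have : (2⁻¹ : ℝ) ^ k * (2 ^ n : ℕ) = (2 ^ (n - k) : ℕ) := by
        push_cast
        rw [← Nat.sub_add_cancel (show k ≤ n by omega), pow_add, Nat.add_sub_cancel, inv_pow]
        field_simp
      rw [this]
      exact_mod_cast hcard
    rw [pow_succ] at h2
    nlinarith

end DirichletCarleson

/-! ### Superposition of the Cantor measures -/

open DirichletCarleson MeasureTheory in
theorem theorem1p2 (φ : ℝ → ℝ)
    (hpos : ∀ x ∈ Set.Ioc 0 (2 * Real.pi), 0 < φ x)
    (hcont : ContinuousOn φ (Set.Ioc 0 (2 * Real.pi)))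
    (hmono : MonotoneOn φ (Set.Ioc 0 (2 * Real.pi)))
    (hanti : StrictAntiOn (fun x : ℝ => φ x / x) (Set.Ioc 0 (2 * Real.pi)))
    (hint : ∫⁻ x in Set.Ioc 0 (2 * Real.pi), ENNReal.ofReal (φ x / x) = ∞) :
    ∃ μ : MeasureTheory.Measure ℂ, MeasureTheory.IsFiniteMeasure μ ∧
      μ DirichletCarleson.diskᶜ = 0 ∧
      DirichletCarleson.OneBoxCondition μ φ ∧
      ¬ DirichletCarleson.IsDirichletCarleson μ := by
  classical
  obtain ⟨c, hc, hscales⟩ := exists_scales hpos hcont hmono hanti hint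
  -- Energies `4 ^ j` outgrow the summable weights `2⁻¹ ^ j`.
  choose n l hl0 hl hlb hφ hM using fun j : ℕ => hscales (4 ^ j)
  have hln : ∀ j, l j (n j) ≤ 1 := fun j => by
    linarith [antitone_of_halving (hl0 j) (hl j) (Nat.zero_le (n j)), hlb j]
  have hw : ∀ j p, ‖cantorPoint (l j) (n j) p‖ < 1 := fun j p => by
    rw [norm_cantorPoint (hln j)]; linarith [hl0 j (n j)]
  let ν : ℕ → Measure ℂ := fun j => uniformMeasure (2 ^ n j) (cantorPoint (l j) (n j))
  let a : ℕ → ℝ≥0 := fun j => 2⁻¹ ^ j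
  have ha : ∑' j, (a j : ℝ≥0∞) = 2 := by
    simp only [a, ENNReal.coe_pow, ENNReal.coe_inv (two_ne_zero' ℝ≥0), ENNReal.coe_ofNat]
    rw [ENNReal.tsum_geometric, ENNReal.one_sub_inv_two, inv_inv]
  let μ : Measure ℂ := Measure.sum fun j => (a j : ℝ≥0∞) • ν j
  have hμ : ∀ S : Set ℂ, μ S = ∑' j, (a j : ℝ≥0∞) * ν j S := fun S => by
    simp only [μ, Measure.sum_apply_of_countable, Measure.smul_apply, smul_eq_mul]
  have hμle : ∀ (S : Set ℂ) (B : ℝ≥0∞), (∀ j, ν j S ≤ B) → μ S ≤ 2 * B := fun S B h => by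
    rw [hμ, ← ha, ← ENNReal.tsum_mul_right]
    exact ENNReal.tsum_le_tsum fun j => by gcongr; exact h j
  -- The constant is `2 / c` times the total weight `2`; the one-box estimate holds for all `ℓ < 1`.
  refine ⟨μ, ⟨?_⟩, ?_, ⟨4 / c, 1, one_pos, fun I ℓ hI hℓ => ?_⟩, ?_⟩
  · exact (hμle _ 1 fun j => uniformMeasure_apply_le_one _ _ _).trans_lt (by norm_num)
  · refine le_antisymm ((hμle _ 0 fun j => ?_).trans (mul_zero _).le) zero_le
    simp only [ν]
    rw [uniformMeasure_apply (by positivity)]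
    have : ∀ p, cantorPoint (l j) (n j) p ∉ diskᶜ := fun p => by simpa [disk] using hw j p
    simp [this]
  · refine (hμle _ _ fun j => uniformMeasure_cantorPoint_carlesonBox_le hmono hc (hl0 j) (hl j)
      (hlb j) (hφ j) hI hℓ).trans (le_of_eq ?_)
    rw [← ENNReal.ofReal_ofNat 2, ← ENNReal.ofReal_mul (by norm_num)]
    congr 1
    ring
  · rintro ⟨C, hC⟩
    have hle : ∀ j, (2 : ℝ) ^ j ≤ C := fun j => by
      have h1 := mul_logEnergy_le_of_smul_uniformMeasure_le (hw j)
        (Measure.le_sum (fun j => (a j : ℝ≥0∞) • ν j) j) hC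
      have h2 := (hM j).trans (le_logEnergy_cantorPoint (hl0 j) (hl j) (hln j))
      have h3 : (a j : ℝ) * 4 ^ j = 2 ^ j := by
        simp only [a, NNReal.coe_pow, NNReal.coe_inv, NNReal.coe_ofNat]
        rw [← mul_pow]; norm_num
      rw [← h3]
      exact (mul_le_mul_of_nonneg_left h2 (a j).2).trans h1
    obtain ⟨j, hj⟩ := pow_unbounded_of_one_lt (C : ℝ) one_lt_two
    exact (hj.trans_le (hle j)).false

end
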